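/- Let $K$ be a field, let $K(s)$ be the field of rational functions over $K$, and let $K_\infty(s)\subset K(s)$ be the ring of proper rational functions, i.e. of all $p/q$ with $p,q\in K[s]$, $q\neq 0$ and $\deg p\le\deg q$ (including $0$). A square matrix over $K_\infty(s)$ is called bicausal if its determinant is a unit of $K_\infty(s)$. For a nonsingular polynomial matrix $L\in K[s]^{n\times n}$ define the $K_\infty(s)$-module \[ U^L = K_\infty(s)^n\big/\bigl(K_\infty(s)^n\cap L\,s^{-1}K_\infty(s)^n\bigr). \] It is well known that there are bicausal matrices $P,Q\in K_\infty(s)^{n\times n}$ and uniquely determined integers $\alpha_1\ge\dots\ge\alpha_t>0$ and $0\le\beta_{t+1}\le\dots\le\beta_n$ such that \[ s^{-1}L=P\,\operatorname{diag}\bigl(s^{-\alpha_1},\dots,s^{-\alpha_t},s^{\beta_{t+1}},\dots,s^{\beta_n}\bigr)\,Q , \] and $s^{-\alpha_1},\dots,s^{-\alpha_t}$ are called the infinite elementary divisors of $L$ (possibly $t=0$). Theorem. Let $L\in K[s]^{n\times n}$ and $L_1\in K[s]^{n_1\times n_1}$ be nonsingular polynomial matrices with infinite elementary divisors $s^{-\alpha_1},\dots,s^{-\alpha_t}$,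 $\alpha_1\ge\dots\ge\alpha_t>0$, and $s^{-\gamma_1},\dots,s^{-\gamma_p}$, $\gamma_1\ge\dots\ge\gamma_p>0$, respectively. Then: (i) there exists a surjective $K_\infty(s)$-module homomorphism $U^L\to U^{L_1}$ if and only if $t\ge p$ and $\alpha_i\ge\gamma_i$ for $i=1,\dots,p$; (ii) there exists an injective $K_\infty(s)$-module homomorphism $U^L\to U^{L_1}$ if and only if $t\le p$ and $\alpha_i\le\gamma_i$ for $i=1,\dots,t$. -/

import Mathlib

open Polynomial

/-- The ring `K_∞(s)` of proper rational functions over `K`: the quotients `p / q` of polynomials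
with `q ≠ 0` and `deg p ≤ deg q` (the zero function is the case `p = 0`). -/
def properRatFunc (K : Type*) [Field K] : Subring (RatFunc K) where
  carrier := {f | ∃ p q : K[X], q ≠ 0 ∧ p.degree ≤ q.degree ∧
    f = algebraMap K[X] (RatFunc K) p / algebraMap K[X] (RatFunc K) q}
  zero_mem' := ⟨0, 1, one_ne_zero, by simp, by simp⟩
  one_mem' := ⟨1, 1, one_ne_zero, le_rfl, by simp⟩
  neg_mem' := by
    rintro _ ⟨p, q, hq, hd, rfl⟩
    exact ⟨-p, q, hq, by simpa using hd, by simp [neg_div]⟩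
  mul_mem' := by
    rintro _ _ ⟨p, q, hq, hd, rfl⟩ ⟨p', q', hq', hd', rfl⟩
    refine ⟨p * p', q * q', mul_ne_zero hq hq', ?_, by simp [div_mul_div_comm]⟩
    rw [degree_mul, degree_mul]
    exact add_le_add hd hd'
  add_mem' := by
    rintro _ _ ⟨p, q, hq, hd, rfl⟩ ⟨p', q', hq', hd', rfl⟩
    refine ⟨p * q' + q * p', q * q', mul_ne_zero hq hq', ?_, ?_⟩
    · refine (degree_add_le _ _).trans (max_le ?_ ?_)
      · rw [degree_mul, degree_mul]
        exact add_le_add hd le_rfl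
      · rw [degree_mul, degree_mul]
        exact add_le_add le_rfl hd'
    · have h := RatFunc.algebraMap_ne_zero hq
      have h' := RatFunc.algebraMap_ne_zero hq'
      rw [div_add_div _ _ h h']
      simp

/-- The rational matrix `s⁻¹ L` attached to a polynomial matrix `L`. -/
noncomputable def sInvMul {K : Type*} [Field K] {n : ℕ} (L : Matrix (Fin n) (Fin n) K[X]) :
    Matrix (Fin n) (Fin n) (RatFunc K) :=
  (RatFunc.X : RatFunc K)⁻¹ • L.map (algebraMap K[X] (RatFunc K))

/-- The `K_∞(s)`-submodule `K_∞(s)^n ∩ L s⁻¹ K_∞(s)^n` of `K_∞(s)^n`. -/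
def relSubmodule {K : Type*} [Field K] {n : ℕ} (L : Matrix (Fin n) (Fin n) K[X]) :
    Submodule (properRatFunc K) (Fin n → properRatFunc K) where
  carrier := {x | ∃ y : Fin n → properRatFunc K,
    (fun i => (x i : RatFunc K)) = (sInvMul L).mulVec (fun i => (y i : RatFunc K))}
  zero_mem' := ⟨0, by
    have h : (fun i => (((0 : Fin n → properRatFunc K) i : properRatFunc K) : RatFunc K)) = 0 := by
      ext i; simp
    rw [h, Matrix.mulVec_zero]⟩
  add_mem' := by
    rintro x x' ⟨y, hy⟩ ⟨y', hy'⟩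
    refine ⟨y + y', ?_⟩
    have h : (fun i => ((y + y') i : RatFunc K)) =
        (fun i => (y i : RatFunc K)) + (fun i => (y' i : RatFunc K)) := by
      ext i; simp
    rw [h, Matrix.mulVec_add, ← hy, ← hy']
    ext i; simp
  smul_mem' := by
    rintro c x ⟨y, hy⟩
    refine ⟨c • y, ?_⟩
    have h : (fun i => ((c • y) i : RatFunc K)) =
        (c : RatFunc K) • (fun i => (y i : RatFunc K)) := by
      ext i; simp
    rw [h, Matrix.mulVec_smul, ← hy]
    ext i; simp

/-- The `K_∞(s)`-module `U^L = K_∞(s)^n / (K_∞(s)^n ∩ L s⁻¹ K_∞(s)^n)`. -/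
abbrev UModule {K : Type*} [Field K] {n : ℕ} (L : Matrix (Fin n) (Fin n) K[X]) :=
  (Fin n → properRatFunc K) ⧸ relSubmodule L

/-- `s^{-α₁}, …, s^{-α_t}` are the infinite elementary divisors of `L`, listed such that
`α₁ ≥ ⋯ ≥ α_t > 0`: there are bicausal matrices `P`, `Q` (that is, matrices over `K_∞(s)` whose
determinant is a unit of `K_∞(s)`) with
`s⁻¹ L = P diag(s^{-α₁}, …, s^{-α_t}, s^{β₁}, …, s^{β_r}) Q`, where `0 ≤ β₁ ≤ ⋯ ≤ β_r`
and `t + r = n`. -/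
def IsInfiniteElementaryDivisors {K : Type*} [Field K] {n : ℕ}
    (L : Matrix (Fin n) (Fin n) K[X]) {t : ℕ} (α : Fin t → ℕ) : Prop :=
  Antitone α ∧ (∀ i, 0 < α i) ∧
    ∃ (r : ℕ) (h : t + r = n) (β : Fin r → ℕ) (P Q : Matrix (Fin n) (Fin n) (properRatFunc K)),
      Monotone β ∧ IsUnit P.det ∧ IsUnit Q.det ∧
      sInvMul L =
        P.map (properRatFunc K).subtype *
          Matrix.diagonal (fun i : Fin n =>
            (RatFunc.X : RatFunc K) ^
              (Fin.append (fun j => -(α j : ℤ)) (fun j => (β j : ℤ)) (Fin.cast h.symm i))) *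
          Q.map (properRatFunc K).subtype

/-! Write `R` for the ring of proper rational functions and `π = s⁻¹`. Every element of `R` is a
unit or divisible by `π`, so `R/π` is a field. Bicausal factors only change bases, and the entries
`s^β` impose no relation because `R ⊆ s^β R`; hence `U^L ≅ ⨁ R/π^{α i}`
(`IsInfiniteElementaryDivisors.nonempty_equiv`).

For such sums, necessity is a dimension count over `R/π` at a single bad index `i`: a surjection is
reduced modulo `π` (`le_of_surjective`), an injection is restricted to the socle
(`le_of_injective`). Either way `i + 1` independent directions have to be matched by only `i`.
Sufficiency is explicit: project onto coordinates, or embed `R/π^a` in `R/π^b` as multiplication by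
`π^(b-a)`. -/

/-! ### Homomorphisms between finite sums of cyclic modules `R/π^a`. -/

section CyclicSums

variable {R : Type*} [CommRing R]

/-- The submodule `⨁ (π ^ α i)` of the free module `R ^ ι`. -/
def powSubmodule {ι : Type*} (π : R) (α : ι → ℕ) : Submodule R (ι → R) :=
  Submodule.pi Set.univ fun i => Ideal.span {π ^ α i}

theorem mem_powSubmodule {ι : Type*} {π : R} {α : ι → ℕ} {x : ι → R} :
    x ∈ powSubmodule π α ↔ ∀ i, π ^ α i ∣ x i := by
  simp [powSubmodule, Submodule.mem_pi, Ideal.mem_span_singleton]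

/-- A homomorphism between direct sums of cyclic modules is given by a matrix. -/
theorem exists_matrix_of_linearMap {ι κ : Type*} [Fintype ι] [DecidableEq ι] {π : R}
    {α : ι → ℕ} {γ : κ → ℕ}
    (φ : ((ι → R) ⧸ powSubmodule π α) →ₗ[R] ((κ → R) ⧸ powSubmodule π γ)) :
    ∃ A : ι → κ → R,
      (∀ x, φ (Submodule.Quotient.mk x) = Submodule.Quotient.mk (∑ l, x l • A l)) ∧
      ∀ l m, π ^ γ m ∣ π ^ α l * A l m := by
  choose A hA using fun l : ι => Submodule.Quotient.mk_surjective _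
    (φ (Submodule.Quotient.mk (Pi.single l 1)))
  have key : ∀ x, φ (Submodule.Quotient.mk x) = Submodule.Quotient.mk (∑ l, x l • A l) := by
    intro x
    have hx : x = ∑ l, x l • (Pi.single l 1 : ι → R) := by
      ext j
      simp [Finset.sum_apply, Pi.single_apply]
    conv_lhs => rw [hx]
    simp only [← Submodule.mkQ_apply, map_sum, map_smul] at hA ⊢
    simp only [hA]
  refine ⟨A, key, fun l m => ?_⟩
  have h0 : (Submodule.Quotient.mk (π ^ α l • (Pi.single l 1 : ι → R)) :
      (ι → R) ⧸ powSubmodule π α) = 0 := by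
    rw [Submodule.Quotient.mk_eq_zero, mem_powSubmodule]
    intro i
    by_cases h : i = l
    · subst h; simp
    · simp [h]
  have h1 : (Submodule.Quotient.mk (π ^ α l • A l) : (κ → R) ⧸ powSubmodule π γ) = 0 := by
    rw [Submodule.Quotient.mk_smul, hA, ← map_smul, ← Submodule.Quotient.mk_smul, h0, map_zero]
  rw [Submodule.Quotient.mk_eq_zero, mem_powSubmodule] at h1
  simpa using h1 m

theorem sum_subtype_eq_of_forall_eq_zero {ι M : Type*} [Fintype ι] [AddCommMonoid M]
    {P : ι → Prop} [DecidablePred P] {f : ι → M} (h : ∀ i, ¬ P i → f i = 0) :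
    ∑ i : {i // P i}, f i = ∑ i, f i := by
  rw [← Finset.sum_subtype (Finset.univ.filter P) (by simp) f]
  exact Finset.sum_filter_of_ne fun i _ hi => by_contra fun hP => hi (h i hP)

theorem card_subtype_val_lt_le {t : ℕ} (i : ℕ) : Fintype.card {l : Fin t // l.1 < i} ≤ i := by
  simpa using Fintype.card_le_of_injective
    (fun l : {l : Fin t // l.1 < i} => (⟨l.1.1, l.2⟩ : Fin i))
    (fun a b h => Subtype.ext (Fin.ext (by simpa using h)))

theorem card_subtype_le_eq {p : ℕ} (i : Fin p) : Fintype.card {m : Fin p // m ≤ i} = i.1 + 1 := by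
  rw [Fintype.card_subtype, ← Fin.card_Iic]
  congr 1
  ext
  simp

variable {π : R} {t p : ℕ} {α : Fin t → ℕ} {γ : Fin p → ℕ}

/-- Treats a missing index and a failed inequality as one kind of failure, so that both necessity
proofs can argue at a single index. -/
theorem le_of_forall_exists_lt {P : Fin p → Fin t → Prop}
    (h : ∀ i : Fin p, ∃ h : i.1 < t, P i ⟨i.1, h⟩) :
    ∃ h : p ≤ t, ∀ i : Fin p, P i (Fin.castLE h i) := by
  have hpt : p ≤ t := by
    by_contra! hlt
    obtain ⟨h', -⟩ := h ⟨t, hlt⟩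
    exact lt_irrefl _ h'
  exact ⟨hpt, fun i => (h i).2⟩

theorem forall_lt_of_not_exists (hα : Antitone α) {i c : ℕ}
    (h : ¬ ∃ h : i < t, c ≤ α ⟨i, h⟩) {l : Fin t} (hl : i ≤ l.1) : α l < c := by
  by_contra! hc
  exact h ⟨hl.trans_lt l.2, hc.trans (hα (by exact hl))⟩

theorem le_of_surjective [IsDomain R] (hπ : π ≠ 0) (hmax : (Ideal.span {π}).IsMaximal)
    (hα : Antitone α) (hγ : Antitone γ) (hγ0 : ∀ i, 0 < γ i)
    (φ : ((Fin t → R) ⧸ powSubmodule π α) →ₗ[R] ((Fin p → R) ⧸ powSubmodule π γ))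
    (hφ : Function.Surjective φ) :
    ∃ h : p ≤ t, ∀ i : Fin p, γ i ≤ α (Fin.castLE h i) := by
  refine le_of_forall_exists_lt (P := fun i j => γ i ≤ α j) fun i => ?_
  by_contra hcon
  obtain ⟨A, hA, hdvd⟩ := exists_matrix_of_linearMap φ
  let _ := Ideal.Quotient.field (Ideal.span {π})
  let q := Ideal.Quotient.mk (Ideal.span {π})
  have hq : ∀ x, q x = 0 ↔ π ∣ x := fun x => by
    rw [Ideal.Quotient.eq_zero_iff_mem, Ideal.mem_span_singleton]
  -- From a bad index on, sources have smaller exponent than the targets `m ≤ i`, so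
  -- well-definedness forces these entries into `(π)`.
  have hzero : ∀ (l : Fin t) (m : Fin p), i.1 ≤ l.1 → m ≤ i → q (A l m) = 0 := by
    intro l m hl hm
    have hlt : α l < γ m := (forall_lt_of_not_exists hα hcon hl).trans_le (hγ hm)
    have h1 : π ^ α l * π ∣ π ^ α l * A l m := by
      rw [← pow_succ]
      exact (pow_dvd_pow π hlt).trans (hdvd l m)
    exact (hq _).2 ((mul_dvd_mul_iff_left (pow_ne_zero _ hπ)).1 h1)
  -- The induced map modulo `π` onto the first `i + 1` target coordinates; only the sources `l < i`
  -- contribute.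
  let T := Matrix.mulVecLin (Matrix.of fun (m : {m : Fin p // m ≤ i})
    (l : {l : Fin t // l.1 < i.1}) => q (A l m))
  have hT : Function.Surjective T := by
    intro y
    choose y' hy' using fun m => Ideal.Quotient.mk_surjective (I := Ideal.span {π}) (y m)
    obtain ⟨x, hx⟩ := hφ (Submodule.Quotient.mk fun m => if h : m ≤ i then y' ⟨m, h⟩ else 0)
    obtain ⟨x, rfl⟩ := Submodule.Quotient.mk_surjective _ x
    rw [hA, Submodule.Quotient.eq, mem_powSubmodule] at hx
    refine ⟨fun l => q (x l), ?_⟩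
    ext m
    -- Positivity of `γ m` is what lets a congruence modulo `π ^ γ m` descend to `R/π`.
    have h1 := (hq _).2 ((dvd_pow_self π (hγ0 m).ne').trans (hx m))
    simp only [Pi.sub_apply, Finset.sum_apply, Pi.smul_apply, smul_eq_mul, m.2, dite_true,
      map_sub, map_sum, map_mul, sub_eq_zero] at h1
    have h2 : q (y' m) = y m := hy' m
    rw [← h2, ← h1]
    simp only [T, Matrix.mulVecLin_apply, Matrix.mulVec, dotProduct, Matrix.of_apply]
    rw [sum_subtype_eq_of_forall_eq_zero (P := fun l : Fin t => l.1 < i.1)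
      (f := fun l => q (A l m) * q (x l))]
    · exact Finset.sum_congr rfl fun l _ => mul_comm _ _
    · intro l hl
      rw [hzero l m (not_lt.1 hl) m.2, zero_mul]
  have h := LinearMap.finrank_le_finrank_of_surjective hT
  rw [Module.finrank_fintype_fun_eq_card, Module.finrank_fintype_fun_eq_card,
    card_subtype_le_eq] at h
  exact absurd (h.trans (card_subtype_val_lt_le _)) (by simp)

theorem le_of_injective [IsDomain R] (hπ : π ≠ 0) (hmax : (Ideal.span {π}).IsMaximal)
    (hα : Antitone α) (hα0 : ∀ i, 0 < α i) (hγ : Antitone γ) (hγ0 : ∀ i, 0 < γ i)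
    (φ : ((Fin t → R) ⧸ powSubmodule π α) →ₗ[R] ((Fin p → R) ⧸ powSubmodule π γ))
    (hφ : Function.Injective φ) :
    ∃ h : t ≤ p, ∀ i : Fin t, α i ≤ γ (Fin.castLE h i) := by
  refine le_of_forall_exists_lt (P := fun i j => α i ≤ γ j) fun i => ?_
  by_contra hcon
  obtain ⟨A, hA, hdvd⟩ := exists_matrix_of_linearMap φ
  let _ := Ideal.Quotient.field (Ideal.span {π})
  let q := Ideal.Quotient.mk (Ideal.span {π})
  have hq : ∀ x, q x = 0 ↔ π ∣ x := fun x => by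
    rw [Ideal.Quotient.eq_zero_iff_mem, Ideal.mem_span_singleton]
  -- The socle of `R/π^a` is generated by `π^(a-1)`; `C` is the matrix of the map on socle
  -- generators.
  have hC : ∀ (m : Fin t) (l : Fin p), ∃ c,
      π ^ (α m - 1) * A m l = π ^ (γ l - 1) * c := by
    intro m l
    have h1 := hdvd m l
    rw [← Nat.sub_add_cancel (hα0 m), ← Nat.sub_add_cancel (hγ0 l), pow_succ', pow_succ',
      mul_assoc] at h1
    exact (mul_dvd_mul_iff_left hπ).1 h1
  choose C hC using hC
  let T := Matrix.mulVecLin (Matrix.of fun (l : {l : Fin p // l.1 < i.1})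
    (m : {m : Fin t // m ≤ i}) => q (C m l))
  have hker : LinearMap.ker T ≠ ⊥ := by
    apply LinearMap.ker_ne_bot_of_finrank_lt
    rw [Module.finrank_fintype_fun_eq_card, Module.finrank_fintype_fun_eq_card,
      card_subtype_le_eq]
    exact Nat.lt_succ_of_le (card_subtype_val_lt_le _)
  obtain ⟨y, hy, hy0⟩ := (Submodule.ne_bot_iff _).1 hker
  -- A kernel vector of `T` lifts to a socle element `x` killed by `φ`; injectivity then forces the
  -- vector to vanish.
  apply hy0
  choose y' hy' using fun m => Ideal.Quotient.mk_surjective (I := Ideal.span {π}) (y m)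
  let d : Fin t → R := fun m => if h : m ≤ i then y' ⟨m, h⟩ else 0
  let x : Fin t → R := fun m => π ^ (α m - 1) * d m
  have hx : φ (Submodule.Quotient.mk x) = 0 := by
    rw [hA, Submodule.Quotient.mk_eq_zero, mem_powSubmodule]
    intro l
    have hsum : (∑ m, x m • A m) l = π ^ (γ l - 1) * ∑ m, d m * C m l := by
      rw [Finset.sum_apply, Finset.mul_sum]
      refine Finset.sum_congr rfl fun m _ => ?_
      simp only [Pi.smul_apply, smul_eq_mul, x]
      linear_combination d m * hC m l
    by_cases hl : l.1 < i.1
    · rw [hsum]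
      conv_lhs => rw [← Nat.sub_add_cancel (hγ0 l), pow_succ]
      refine mul_dvd_mul_left _ ((hq _).1 ?_)
      have h1 := congrFun (LinearMap.mem_ker.1 hy) ⟨l, hl⟩
      simp only [T, Matrix.mulVecLin_apply, Matrix.mulVec, dotProduct, Matrix.of_apply,
        Pi.zero_apply] at h1
      rw [← h1, map_sum, ← sum_subtype_eq_of_forall_eq_zero (P := fun m : Fin t => m ≤ i)]
      · refine Finset.sum_congr rfl fun m _ => ?_
        simp only [d, m.2, dite_true, map_mul]
        rw [mul_comm]
        exact congrArg _ (hy' m)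
      · intro m hm
        simp [d, hm]
    -- Here `γ l < α m` for all `m ≤ i`, so `π ^ (α m - 1)` is already zero in the `l`-th target
    -- summand.
    · rw [Finset.sum_apply]
      refine Finset.dvd_sum fun m _ => ?_
      by_cases hm : m ≤ i
      · have h2 := (forall_lt_of_not_exists hγ hcon (not_lt.1 hl)).trans_le (hα hm)
        simp only [Pi.smul_apply, smul_eq_mul, x]
        exact Dvd.dvd.mul_right (Dvd.dvd.mul_right (pow_dvd_pow _ (by omega)) _) _
      · simp [x, d, hm]
  rw [← map_zero φ] at hx
  have hx0 := hφ hx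
  rw [Submodule.Quotient.mk_eq_zero, mem_powSubmodule] at hx0
  ext m
  have h1 := hx0 m
  simp only [x, d, m.2, dite_true] at h1
  rw [← Nat.sub_add_cancel (hα0 m), pow_succ, Nat.add_sub_cancel] at h1
  have h2 := (hq _).2 ((mul_dvd_mul_iff_left (pow_ne_zero _ hπ)).1 h1)
  exact (hy' m).symm.trans h2

theorem exists_surjective_of_le (h : p ≤ t) (hle : ∀ i, γ i ≤ α (Fin.castLE h i)) :
    ∃ φ : ((Fin t → R) ⧸ powSubmodule π α) →ₗ[R] ((Fin p → R) ⧸ powSubmodule π γ),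
      Function.Surjective φ := by
  have hinj := Fin.castLE_injective h
  refine ⟨Submodule.mapQ _ _ (LinearMap.funLeft R R (Fin.castLE h)) ?_, ?_⟩
  · intro x hx
    rw [mem_powSubmodule] at hx
    rw [Submodule.mem_comap, mem_powSubmodule]
    exact fun i => (pow_dvd_pow π (hle i)).trans (hx _)
  · intro y
    obtain ⟨y, rfl⟩ := Submodule.Quotient.mk_surjective _ y
    obtain ⟨x, rfl⟩ := LinearMap.funLeft_surjective_of_injective R R _ hinj y
    exact ⟨Submodule.Quotient.mk x, Submodule.mapQ_apply _ _ _ _⟩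

theorem exists_injective_of_le [IsDomain R] (hπ : π ≠ 0) (h : t ≤ p)
    (hle : ∀ i, α i ≤ γ (Fin.castLE h i)) :
    ∃ φ : ((Fin t → R) ⧸ powSubmodule π α) →ₗ[R] ((Fin p → R) ⧸ powSubmodule π γ),
      Function.Injective φ := by
  let f : (Fin t → R) →ₗ[R] (Fin p → R) := LinearMap.pi fun j =>
    if hj : j.1 < t then π ^ (γ j - α ⟨j, hj⟩) • LinearMap.proj ⟨j, hj⟩ else 0
  -- Equality, not just inclusion: one direction makes `f` descend to the quotients, the other makes
  -- the descended map injective.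
  have hf : (powSubmodule π γ).comap f = powSubmodule π α := by
    ext x
    rw [Submodule.mem_comap, mem_powSubmodule, mem_powSubmodule]
    have key : ∀ i : Fin t, π ^ γ (Fin.castLE h i) ∣ f x (Fin.castLE h i) ↔ π ^ α i ∣ x i := by
      intro i
      have h1 : f x (Fin.castLE h i) = π ^ (γ (Fin.castLE h i) - α i) * x i := by
        simp [f]
      rw [h1, ← mul_dvd_mul_iff_left (b := π ^ α i)
        (pow_ne_zero (γ (Fin.castLE h i) - α i) hπ), ← pow_add, Nat.sub_add_cancel (hle i)]
    refine ⟨fun H i => (key i).1 (H _), fun H j => ?_⟩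
    by_cases hj : j.1 < t
    · exact (key ⟨j, hj⟩).2 (H _)
    · simp [f, hj]
  refine ⟨Submodule.mapQ _ _ f hf.ge, ?_⟩
  rw [← LinearMap.ker_eq_bot, Submodule.ker_mapQ, hf, Submodule.mkQ_map_self]

end CyclicSums

/-! ### The uniformizer `s⁻¹` and the cyclic decomposition of `U^L`. -/

section ProperRatFunc

variable {K : Type*} [Field K]

/-- The uniformizer `s⁻¹` of the ring of proper rational functions. -/
noncomputable def properRatFunc.invX (K : Type*) [Field K] : properRatFunc K :=
  ⟨(RatFunc.X : RatFunc K)⁻¹, 1, X, X_ne_zero, by simp, by simp⟩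

theorem properRatFunc.coe_invX :
    (properRatFunc.invX K : RatFunc K) = (RatFunc.X : RatFunc K)⁻¹ := rfl

theorem properRatFunc.invX_ne_zero : properRatFunc.invX K ≠ 0 := by
  intro h
  have h1 := congrArg (Subtype.val) h
  simp [properRatFunc.coe_invX, RatFunc.X_ne_zero] at h1

/-- If `deg p < deg q` then `s p / q` is still proper; if the degrees agree then `q / p` is proper.
-/
theorem properRatFunc.invX_dvd_or_isUnit (f : properRatFunc K) :
    properRatFunc.invX K ∣ f ∨ IsUnit f := by
  obtain ⟨f, p, q, hq, hd, rfl⟩ := f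
  have hq' := RatFunc.algebraMap_ne_zero hq
  rcases hd.lt_or_eq with hlt | heq
  · left
    refine ⟨⟨_, X * p, q, hq, ?_, rfl⟩, ?_⟩
    · rw [mul_comm, degree_mul_X]
      exact Nat.WithBot.add_one_le_of_lt hlt
    · apply Subtype.ext
      have hX := RatFunc.X_ne_zero (K := K)
      simp only [Subring.coe_mul, properRatFunc.coe_invX, map_mul, RatFunc.algebraMap_X]
      field_simp
  · right
    have hp : p ≠ 0 := by
      rintro rfl
      rw [degree_zero] at heq
      exact hq (degree_eq_bot.1 heq.symm)
    have hp' := RatFunc.algebraMap_ne_zero hp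
    refine IsUnit.of_mul_eq_one ⟨_, q, p, hp, heq.ge, rfl⟩ ?_
    apply Subtype.ext
    simp only [Subring.coe_mul, Subring.coe_one]
    field_simp

theorem properRatFunc.not_isUnit_invX : ¬ IsUnit (properRatFunc.invX K) := by
  intro h
  obtain ⟨⟨_, p, q, hq, hd, rfl⟩, hf⟩ := h.exists_right_inv
  have h1 := congrArg Subtype.val hf
  have hq' := RatFunc.algebraMap_ne_zero hq
  have hX := RatFunc.X_ne_zero (K := K)
  simp only [Subring.coe_mul, Subring.coe_one, properRatFunc.coe_invX] at h1
  field_simp at h1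
  rw [← RatFunc.algebraMap_X, ← map_mul] at h1
  have h2 := RatFunc.algebraMap_injective K h1
  rw [h2, mul_comm, degree_mul_X] at hd
  have hq0 : q ≠ 0 := hq
  rw [degree_eq_natDegree hq0] at hd
  norm_cast at hd
  omega

theorem properRatFunc.isMaximal_span_invX :
    (Ideal.span {properRatFunc.invX K}).IsMaximal := by
  refine Ideal.isMaximal_iff.2 ⟨?_, fun J x hJ hx hxJ => ?_⟩
  · rw [Ideal.mem_span_singleton, ← isUnit_iff_dvd_one]
    exact properRatFunc.not_isUnit_invX
  · rw [Ideal.mem_span_singleton] at hx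
    have := (properRatFunc.invX_dvd_or_isUnit x).resolve_left hx
    exact (Ideal.eq_top_iff_one J).1 (Ideal.eq_top_of_isUnit_mem J hxJ this)

/-- Multiplication by a proper matrix commutes with the inclusion of proper vectors in `K(s)^n`. -/
theorem coe_mulVec {m n : Type*} [Fintype n] (P : Matrix m n (properRatFunc K))
    (x : n → properRatFunc K) :
    (fun i => ((P.mulVec x) i : RatFunc K)) =
      (P.map (properRatFunc K).subtype).mulVec (fun i => (x i : RatFunc K)) := by
  ext i
  exact RingHom.map_mulVec (properRatFunc K).subtype P x i

/-- `U^L` is the direct sum of the cyclic modules attached to the infinite elementary divisors. -/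
theorem IsInfiniteElementaryDivisors.nonempty_equiv {n : ℕ} {L : Matrix (Fin n) (Fin n) K[X]}
    {t : ℕ} {α : Fin t → ℕ} (h : IsInfiniteElementaryDivisors L α) :
    Nonempty (UModule L ≃ₗ[properRatFunc K]
      ((Fin t → properRatFunc K) ⧸ powSubmodule (properRatFunc.invX K) α)) := by
  obtain ⟨-, -, r, rfl, β, P, Q, -, hP, hQ, hL⟩ := h
  have hPP := Matrix.mul_nonsing_inv P hP
  have hPP' := Matrix.nonsing_inv_mul P hP
  have hQQ := Matrix.mul_nonsing_inv Q hQ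
  have hX := RatFunc.X_ne_zero (K := K)
  -- Change basis by `P⁻¹`, then discard the coordinates belonging to the `s^β`.
  let g : (Fin (t + r) → properRatFunc K) →ₗ[properRatFunc K] (Fin t → properRatFunc K) :=
    (LinearMap.funLeft _ _ (Fin.castAdd r)).comp P⁻¹.mulVecLin
  have hg : Function.Surjective g := by
    intro z
    obtain ⟨y, rfl⟩ := LinearMap.funLeft_surjective_of_injective (properRatFunc K)
      (properRatFunc K) _ (Fin.castAdd_injective t r) z
    exact ⟨P.mulVec y, by simp [g, Matrix.mulVec_mulVec, hPP']⟩
  have hrel : relSubmodule L = (powSubmodule (properRatFunc.invX K) α).comap g := by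
    ext x
    rw [Submodule.mem_comap, mem_powSubmodule]
    have hx : x = P.mulVec (P⁻¹.mulVec x) := by simp [Matrix.mulVec_mulVec, hPP]
    have hgx : ∀ i, g x i = P⁻¹.mulVec x (Fin.castAdd r i) := fun _ => rfl
    simp only [hgx]
    generalize P⁻¹.mulVec x = u at hx
    subst hx
    let d : Fin (t + r) → RatFunc K := fun i => (RatFunc.X : RatFunc K) ^
      (Fin.append (fun j => -(α j : ℤ)) (fun j => (β j : ℤ)) i)
    -- `Q` disappears because `y ↦ Q y` is a bijection of the proper vectors.
    have hmem : P.mulVec u ∈ relSubmodule L ↔ ∃ z : Fin (t + r) → properRatFunc K,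
        ∀ i, (u i : RatFunc K) = d i * z i := by
      have hPm : (P⁻¹.map (properRatFunc K).subtype) * (P.map (properRatFunc K).subtype) = 1 := by
        rw [← Matrix.map_mul, hPP']
        simp
      have hLy : ∀ y : Fin (t + r) → properRatFunc K,
          ((fun i => ((P.mulVec u) i : RatFunc K)) =
            (sInvMul L).mulVec (fun i => (y i : RatFunc K))) ↔
          ∀ i, (u i : RatFunc K) = d i * (Q.mulVec y) i := by
        intro y
        have hL' : (sInvMul L).mulVec (fun i => (y i : RatFunc K)) =
            (P.map (properRatFunc K).subtype).mulVec
              (fun i => d i * ((Q.mulVec y) i : RatFunc K)) := by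
          rw [hL, ← Matrix.mulVec_mulVec, ← Matrix.mulVec_mulVec, ← coe_mulVec]
          congr 1
          ext i
          rw [Matrix.mulVec_diagonal]
          rfl
        rw [coe_mulVec, hL', ← funext_iff (f := fun i => (u i : RatFunc K))]
        refine ⟨fun H => ?_, fun H => congrArg _ H⟩
        have H' := congrArg (P⁻¹.map (properRatFunc K).subtype).mulVec H
        simpa only [Matrix.mulVec_mulVec, hPm, Matrix.one_mulVec] using H'
      refine ⟨fun ⟨y, hy⟩ => ⟨_, (hLy y).1 hy⟩, fun ⟨z, hz⟩ => ⟨Q⁻¹.mulVec z, (hLy _).2 ?_⟩⟩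
      simpa [Matrix.mulVec_mulVec, hQQ] using hz
    rw [hmem]
    constructor
    · rintro ⟨z, hz⟩ i
      refine ⟨z (Fin.castAdd r i), Subtype.ext ?_⟩
      simpa [d, properRatFunc.coe_invX] using hz (Fin.castAdd r i)
    · intro H
      choose z hz using H
      -- In the last `r` coordinates the equation `u = s^β z` is always solvable, by the proper
      -- function `z = s^(-β) u`.
      refine ⟨Fin.append z fun j => properRatFunc.invX K ^ β j * u (Fin.natAdd t j), ?_⟩
      refine Fin.addCases (fun i => ?_) fun j => ?_
      · simpa [d, properRatFunc.coe_invX] using congrArg Subtype.val (hz i)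
      · simp [d, properRatFunc.coe_invX, hX]
  refine ⟨(Submodule.quotEquivOfEq _ _ hrel).trans (LinearEquiv.ofBijective (Submodule.mapQ _ (powSubmodule (properRatFunc.invX K) α) g le_rfl) ⟨?_, ?_⟩)⟩
  · rw [← LinearMap.ker_eq_bot, Submodule.ker_mapQ, Submodule.mkQ_map_self]
  · intro y
    obtain ⟨y, rfl⟩ := Submodule.Quotient.mk_surjective _ y
    obtain ⟨x, rfl⟩ := hg y
    exact ⟨Submodule.Quotient.mk x, Submodule.mapQ_apply _ _ _ _⟩

end ProperRatFunc

theorem mainTheorem4 {K : Type*} [Field K] {n n₁ : ℕ}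
    (L : Matrix (Fin n) (Fin n) K[X]) (L₁ : Matrix (Fin n₁) (Fin n₁) K[X])
    (hL : L.det ≠ 0) (hL₁ : L₁.det ≠ 0)
    {t p : ℕ} (α : Fin t → ℕ) (γ : Fin p → ℕ)
    (hα : IsInfiniteElementaryDivisors L α) (hγ : IsInfiniteElementaryDivisors L₁ γ) :
    ((∃ φ : UModule L →ₗ[properRatFunc K] UModule L₁, Function.Surjective φ) ↔
      ∃ h : p ≤ t, ∀ i : Fin p, γ i ≤ α (Fin.castLE h i)) ∧
    ((∃ φ : UModule L →ₗ[properRatFunc K] UModule L₁, Function.Injective φ) ↔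
      ∃ h : t ≤ p, ∀ i : Fin t, α i ≤ γ (Fin.castLE h i)) := by
  obtain ⟨e⟩ := hα.nonempty_equiv
  obtain ⟨e₁⟩ := hγ.nonempty_equiv
  have hπ := properRatFunc.invX_ne_zero (K := K)
  have hmax := properRatFunc.isMaximal_span_invX (K := K)
  refine ⟨⟨?_, ?_⟩, ⟨?_, ?_⟩⟩
  · rintro ⟨φ, hφ⟩
    exact le_of_surjective hπ hmax hα.1 hγ.1 hγ.2.1
      (e₁.toLinearMap ∘ₗ φ ∘ₗ e.symm.toLinearMap)
      (e₁.surjective.comp (hφ.comp e.symm.surjective))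
  · rintro ⟨h, hle⟩
    obtain ⟨φ, hφ⟩ := exists_surjective_of_le (π := properRatFunc.invX K) h hle
    exact ⟨e₁.symm.toLinearMap ∘ₗ φ ∘ₗ e.toLinearMap,
      e₁.symm.surjective.comp (hφ.comp e.surjective)⟩
  · rintro ⟨φ, hφ⟩
    exact le_of_injective hπ hmax hα.1 hα.2.1 hγ.1 hγ.2.1
      (e₁.toLinearMap ∘ₗ φ ∘ₗ e.symm.toLinearMap)
      (e₁.injective.comp (hφ.comp e.symm.injective))
  · rintro ⟨h, hle⟩
    obtain ⟨φ, hφ⟩ := exists_injective_of_le hπ h hle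
    exact ⟨e₁.symm.toLinearMap ∘ₗ φ ∘ₗ e.toLinearMap,
      e₁.symm.injective.comp (hφ.comp e.injective)⟩
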